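/- Let $n\ge 0$ and let $(V,0)\subset(\mathbb{C}^{n+1},0)$ be a hypersurface singularity given by an equation $f=0$, where $f\in\mathcal{O}_{\mathbb{C}^{n+1},0}$ is a germ of a holomorphic function with $f(0)=0$. Let $f=f_d+f_{d+1}+\cdots$ be its expansion into homogeneous polynomials ($\deg f_k=k$) with $f_d\neq 0$, and let $\mathcal{O}_{V,0}=\mathcal{O}_{\mathbb{C}^{n+1},0}/(f)$, with maximal ideal $\mathfrak{m}$. An arc on $(V,0)$ is a germ of a holomorphic map $\phi:(\mathbb{C},0)\to(V,0)$. For $g\in\mathcal{O}_{V,0}$ let $v_\phi(g)\in\mathbb{Z}_{\ge 0}\cup\{+\infty\}$ be the order of $g\circ\phi$ at the origin ($+\infty$ if $g\circ\phi\equiv 0$), and let $v(g)$ be the minimum of $v_\phi(g)$ over all arcs $\phi$ on $(V,0)$. The arc filtration of $\mathcal{O}_{V,0}$ is given by the ideals $F_i=\{g\in\mathcal{O}_{V,0} : v(g)\ge i\}$, $i\ge 0$. Suppose that the tangent cone $\{f_d=0\}\subset\mathbb{C}^{n+1}$ is reduced, i.e. that the ring $\mathbb{C}[x_0,\dots,x_n]/(f_d)$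 is reduced. Then $F_i=\mathfrak{m}^i$ for all $i\ge 0$. Hence the complex vector spaces $F_i/F_{i+1}$ are finite-dimensional, and the Poincaré series of the arc filtration is $$P_{V,0}(t)=\sum_{i\ge 0}\dim_{\mathbb{C}}(F_i/F_{i+1})\,t^i=\frac{1-t^d}{(1-t)^{n+1}}.$$ -/

import Mathlib

open Filter Topology

noncomputable section

/-- The ring of germs at the origin of holomorphic functions on a complex normed space `E`,
as a subring of the ring of all germs at `0` of functions `E → ℂ`. -/
def HolGerm (E : Type*) [NormedAddCommGroup E] [NormedSpace ℂ E] :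
    Subring (Germ (𝓝 (0 : E)) ℂ) where
  carrier := {g | ∃ G : E → ℂ, AnalyticAt ℂ G 0 ∧ g = (G : Germ (𝓝 (0 : E)) ℂ)}
  mul_mem' := by
    rintro _ _ ⟨F, hF, rfl⟩ ⟨G, hG, rfl⟩
    exact ⟨F * G, hF.mul hG, rfl⟩
  one_mem' := ⟨1, analyticAt_const, rfl⟩
  add_mem' := by
    rintro _ _ ⟨F, hF, rfl⟩ ⟨G, hG, rfl⟩
    exact ⟨F + G, hF.add hG, rfl⟩
  zero_mem' := ⟨0, analyticAt_const, rfl⟩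
  neg_mem' := by
    rintro _ ⟨F, hF, rfl⟩
    exact ⟨-F, hF.neg, rfl⟩

namespace HolGerm

variable {E : Type*} [NormedAddCommGroup E] [NormedSpace ℂ E]

variable (E) in
/-- The inclusion of the constant functions. -/
def constHom : ℂ →+* HolGerm E where
  toFun c := ⟨((fun _ => c : E → ℂ) : Germ (𝓝 (0 : E)) ℂ), fun _ => c, analyticAt_const, rfl⟩
  map_one' := rfl
  map_mul' _ _ := rfl
  map_zero' := rfl
  map_add' _ _ := rfl

/-- `HolGerm E` is a `ℂ`-algebra through the constant functions. -/
instance : Algebra ℂ (HolGerm E) := (constHom E).toAlgebra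

/-- A germ that does not vanish at the origin is invertible. -/
theorem isUnit_of_value_ne_zero (g : HolGerm E) (hg : (g : Germ (𝓝 (0 : E)) ℂ).value ≠ 0) :
    IsUnit g := by
  obtain ⟨_, G, hG, rfl⟩ := g
  have h0 : G 0 ≠ 0 := hg
  refine IsUnit.of_mul_eq_one
    (⟨((G⁻¹ : E → ℂ) : Germ (𝓝 (0 : E)) ℂ), G⁻¹, hG.inv h0, rfl⟩ : HolGerm E) ?_
  apply Subtype.ext
  apply Germ.coe_eq.2
  filter_upwards [hG.continuousAt.eventually_ne h0] with x hx
  exact mul_inv_cancel₀ hx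

/-- `HolGerm E` is a local ring. -/
instance : IsLocalRing (HolGerm E) :=
  IsLocalRing.of_isUnit_or_isUnit_one_sub_self fun g => by
    by_cases h : (g : Germ (𝓝 (0 : E)) ℂ).value = 0
    · right
      apply isUnit_of_value_ne_zero
      obtain ⟨_, G, hG, rfl⟩ := g
      have h0 : G 0 = 0 := h
      change (1 : ℂ) - G 0 ≠ 0
      simp [h0]
    · exact Or.inl (isUnit_of_value_ne_zero g h)

/-- The maximal ideal consists of the germs that vanish at the origin. -/
theorem mem_maximalIdeal_iff (g : HolGerm E) :
    g ∈ IsLocalRing.maximalIdeal (HolGerm E) ↔ (g : Germ (𝓝 (0 : E)) ℂ).value = 0 := by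
  rw [IsLocalRing.mem_maximalIdeal, mem_nonunits_iff]
  refine ⟨fun h => by_contra fun h' => h (isUnit_of_value_ne_zero g h'), fun h hu => ?_⟩
  have := (hu.map (HolGerm E).subtype).map
    (Germ.valueRingHom : Germ (𝓝 (0 : E)) ℂ →+* ℂ)
  exact this.ne_zero h

/-- The pull-back `g ↦ g ∘ φ` of germs under a holomorphic map germ `φ : (ℂ, 0) → (E, 0)`. -/
def pullback (φ : ℂ → E) (hφ : AnalyticAt ℂ φ 0) (h0 : φ 0 = 0) : HolGerm E →+* HolGerm ℂ where
  toFun g := ⟨(g : Germ (𝓝 (0 : E)) ℂ).compTendsto φ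
      (by simpa [ContinuousAt, h0] using hφ.continuousAt), by
    obtain ⟨_, G, hG, rfl⟩ := g
    exact ⟨G ∘ φ, AnalyticAt.comp (by rwa [h0]) hφ, rfl⟩⟩
  map_one' := rfl
  map_mul' := by
    rintro ⟨_, F, hF, rfl⟩ ⟨_, G, hG, rfl⟩
    rfl
  map_zero' := rfl
  map_add' := by
    rintro ⟨_, F, hF, rfl⟩ ⟨_, G, hG, rfl⟩
    rfl

/-- The order of vanishing at the origin of a holomorphic germ in one variable: the exponent of
the first non-vanishing term of its power series, and `⊤` for the zero germ. -/
def order (g : HolGerm ℂ) : ℕ∞ :=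
  Germ.liftOn (g : Germ (𝓝 (0 : ℂ)) ℂ) (fun G => analyticOrderAt G 0)
    fun _ _ h => analyticOrderAt_congr h

theorem order_zero : order 0 = ⊤ :=
  analyticOrderAt_eq_top.2 (Eventually.of_forall fun _ => rfl)

theorem min_order_le_order_add (g h : HolGerm ℂ) : min (order g) (order h) ≤ order (g + h) := by
  obtain ⟨_, F, hF, rfl⟩ := g
  obtain ⟨_, G, hG, rfl⟩ := h
  exact le_analyticOrderAt_add

theorem order_mul (g h : HolGerm ℂ) : order (g * h) = order g + order h := by
  obtain ⟨_, F, hF, rfl⟩ := g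
  obtain ⟨_, G, hG, rfl⟩ := h
  exact analyticOrderAt_mul hF hG

/-- `g = F 0 + F 1 + F 2 + ⋯` is the expansion of the germ `g` into homogeneous polynomials:
`F k` is homogeneous of degree `k`, and the series converges to `g` near the origin. -/
def IsHomogeneousExpansion {m : ℕ} (g : HolGerm (Fin m → ℂ))
    (F : ℕ → MvPolynomial (Fin m) ℂ) : Prop :=
  (∀ k, (F k).IsHomogeneous k) ∧
    ∃ G : (Fin m → ℂ) → ℂ, (g : Germ (𝓝 (0 : Fin m → ℂ)) ℂ) = G ∧
      ∀ᶠ x in 𝓝 (0 : Fin m → ℂ), HasSum (fun k => MvPolynomial.eval x (F k)) (G x)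

end HolGerm

/-- The coordinate ring `ℂ[x₁, …, x_m] / (p)` of the affine cone `{p = 0}`. -/
abbrev ConeRing {m : ℕ} (p : MvPolynomial (Fin m) ℂ) : Type :=
  MvPolynomial (Fin m) ℂ ⧸ Ideal.span {p}

/-! ### Hypersurface germs

A hypersurface germ `(V, 0)` in `(ℂ^m, 0)` is given by an equation `f = 0`, where `f` is a
holomorphic germ with `f(0) = 0`, that is, an element of the maximal ideal. -/

/-- The local ring `𝒪_{V,0} = 𝒪_{ℂ^m,0} / (f)` of the hypersurface germ `V = {f = 0}`. -/
abbrev LocalRingOf {m : ℕ} (f : IsLocalRing.maximalIdeal (HolGerm (Fin m → ℂ))) : Type :=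
  HolGerm (Fin m → ℂ) ⧸ Ideal.span {(f : HolGerm (Fin m → ℂ))}

namespace LocalRingOf

variable {m : ℕ} (f : IsLocalRing.maximalIdeal (HolGerm (Fin m → ℂ)))

instance : Nontrivial (LocalRingOf f) :=
  Ideal.Quotient.nontrivial_iff.2 fun h =>
    (IsLocalRing.maximalIdeal.isMaximal _).ne_top
      (top_le_iff.1 (h ▸ (Ideal.span_singleton_le_iff_mem _).2 f.2))

instance : IsLocalRing (LocalRingOf f) :=
  IsLocalRing.of_surjective' (Ideal.Quotient.mk _) Ideal.Quotient.mk_surjective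

end LocalRingOf

/-- An arc on `V = {f = 0}`: (a representative of) a germ of a holomorphic map
`φ : (ℂ, 0) → (V, 0)`, so that `φ 0 = 0` and `f ∘ φ` vanishes identically near `0`. -/
structure Arc {m : ℕ} (f : IsLocalRing.maximalIdeal (HolGerm (Fin m → ℂ))) where
  toFun : ℂ → Fin m → ℂ
  analyticAt : AnalyticAt ℂ toFun 0
  map_zero : toFun 0 = 0
  maps_to : HolGerm.pullback toFun analyticAt map_zero (f : HolGerm (Fin m → ℂ)) = 0

section ArcFiltration

variable {m : ℕ} {f : IsLocalRing.maximalIdeal (HolGerm (Fin m → ℂ))}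

/-- The pull-back `𝒪_{V,0} → 𝒪_{ℂ,0}`, `g ↦ g ∘ φ`, along an arc `φ` on `V`. -/
def Arc.comap (φ : Arc f) : LocalRingOf f →+* HolGerm ℂ :=
  Ideal.Quotient.lift _ (HolGerm.pullback φ.toFun φ.analyticAt φ.map_zero) fun a ha => by
    obtain ⟨b, rfl⟩ := Ideal.mem_span_singleton'.1 ha
    rw [map_mul, φ.maps_to, mul_zero]

/-- `v_φ(g)`: the order at the origin of `g ∘ φ`. -/
def Arc.order (φ : Arc f) (g : LocalRingOf f) : ℕ∞ := HolGerm.order (φ.comap g)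

/-- `v(g)`: the minimum of `v_φ(g)` over all arcs `φ` on `V`. -/
def arcOrder (g : LocalRingOf f) : ℕ∞ := ⨅ φ : Arc f, φ.order g

theorem le_arcOrder_iff {i : ℕ∞} {g : LocalRingOf f} :
    i ≤ arcOrder g ↔ ∀ φ : Arc f, i ≤ φ.order g :=
  le_iInf_iff

variable (f) in
/-- The arc filtration `F_i = {g | v(g) ≥ i}`. -/
def arcFiltration (i : ℕ) : Ideal (LocalRingOf f) where
  carrier := {g | (i : ℕ∞) ≤ arcOrder g}
  add_mem' := by
    intro a b ha hb
    refine le_arcOrder_iff.2 fun φ => ?_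
    have h := HolGerm.min_order_le_order_add (φ.comap a) (φ.comap b)
    rw [← map_add] at h
    exact (le_min (le_arcOrder_iff.1 ha φ) (le_arcOrder_iff.1 hb φ)).trans h
  zero_mem' := by
    refine le_arcOrder_iff.2 fun φ => ?_
    rw [Arc.order, map_zero, HolGerm.order_zero]
    exact le_top
  smul_mem' := by
    intro c x hx
    refine le_arcOrder_iff.2 fun φ => ?_
    rw [Arc.order, smul_eq_mul, map_mul, HolGerm.order_mul]
    exact (le_arcOrder_iff.1 hx φ).trans le_add_self

variable (f) in
/-- The complex vector space `F_i / F_{i+1}`. -/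
abbrev ArcGraded (i : ℕ) : Type :=
  (arcFiltration f i).restrictScalars ℂ ⧸
    ((arcFiltration f (i + 1)).restrictScalars ℂ).submoduleOf
      ((arcFiltration f i).restrictScalars ℂ)

variable (f) in
/-- The Poincaré series `P_{V,0}(t) = ∑ dim (F_i / F_{i+1}) t^i` of the arc filtration. -/
def poincareSeries : PowerSeries ℚ :=
  PowerSeries.mk fun i => (Module.finrank ℂ (ArcGraded f i) : ℚ)

end ArcFiltration

end

/-!
The filtration by powers of the maximal ideal `𝔪` of the ring of germs on `ℂ^m` has the polynomial
ring as its associated graded ring: Hadamard's lemma shows that `𝔪` is generated by the coordinates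
(`HolGerm.maximalIdeal_eq_span_coord`), hence every `g ∈ 𝔪 ^ k` has a leading form of degree `k`
(`HolGerm.exists_isLeadingForm`), and leading forms are detected by restricting to lines. The first
non-zero term `F` of the homogeneous expansion of `f` is its leading form.

Orders along arcs are superadditive, so the powers of the maximal ideal of `𝒪_{V,0}` are contained in
the arc filtration. For the converse, let `g ∈ 𝔪 ^ k` have leading form `P` and order greater than
`k` along all arcs on `V`. If `F` did not divide `P`, there would be a smooth point `p` of the affine
cone `F = 0` at which `P` does not vanish (`exists_eval_ne_zero`): this uses that `F` is square-free,
the Nullstellensatz, and that an irreducible polynomial in characteristic zero does not divide all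
its partial derivatives. In the blow-up chart `(t, s) ↦ t (p + s v)` the germ `f` becomes
`t ^ d (F (p + s v) + t r)`, and the implicit function theorem solves the second factor for `s`. This
yields an arc `t p + O(t ^ 2)` on `V`, along which `g` has order exactly `k`
(`exists_arc_forall_order_eq`), a contradiction. So `P = F Q`, and subtracting the multiple `Q f` of
`f` from `g` gives an element of `𝔪 ^ (k + 1)`. Induction on `k` proves `arcFiltration_eq_pow`.

The same argument shows that the forms of degree `k` map onto `F_k / F_{k+1}` with kernel the
multiples of `F`, which determines the dimensions and the Poincaré series.
-/

noncomputable section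

/-! ### Germs of holomorphic functions -/

namespace HolGerm

variable {E E' : Type*} [NormedAddCommGroup E] [NormedSpace ℂ E]
  [NormedAddCommGroup E'] [NormedSpace ℂ E']

/-- The germ at the origin of a function that is analytic there. -/
def of (G : E → ℂ) (hG : AnalyticAt ℂ G 0) : HolGerm E :=
  ⟨(G : Germ (𝓝 (0 : E)) ℂ), G, hG, rfl⟩

theorem exists_of_eq (g : HolGerm E) : ∃ G hG, of G hG = g := by
  obtain ⟨_, G, hG, rfl⟩ := g
  exact ⟨G, hG, rfl⟩

theorem of_eq_of_iff {F G : E → ℂ} {hF : AnalyticAt ℂ F 0} {hG : AnalyticAt ℂ G 0} :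
    of F hF = of G hG ↔ F =ᶠ[𝓝 0] G :=
  Subtype.ext_iff.trans Germ.coe_eq

theorem of_add_of {F G : E → ℂ} (hF : AnalyticAt ℂ F 0) (hG : AnalyticAt ℂ G 0) :
    of F hF + of G hG = of (fun x => F x + G x) (hF.fun_add hG) := rfl

theorem of_mul_of {F G : E → ℂ} (hF : AnalyticAt ℂ F 0) (hG : AnalyticAt ℂ G 0) :
    of F hF * of G hG = of (fun x => F x * G x) (hF.fun_mul hG) := rfl

theorem algebraMap_eq_of (c : ℂ) :
    algebraMap ℂ (HolGerm E) c = of (fun _ => c) analyticAt_const := rfl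

/-- Evaluation of germs at the origin. -/
def valueHom : HolGerm E →ₐ[ℂ] ℂ :=
  { (Germ.valueRingHom : Germ (𝓝 (0 : E)) ℂ →+* ℂ).comp (HolGerm E).subtype with
    commutes' := fun _ => rfl }

theorem valueHom_of (G : E → ℂ) (hG : AnalyticAt ℂ G 0) : valueHom (of G hG) = G 0 := rfl

theorem mem_maximalIdeal_iff_valueHom (g : HolGerm E) :
    g ∈ IsLocalRing.maximalIdeal (HolGerm E) ↔ valueHom g = 0 :=
  mem_maximalIdeal_iff g

theorem sub_algebraMap_valueHom_mem (g : HolGerm E) :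
    g - algebraMap ℂ _ (valueHom g) ∈ IsLocalRing.maximalIdeal (HolGerm E) := by
  rw [mem_maximalIdeal_iff_valueHom, map_sub, AlgHom.commutes]
  exact sub_self _

/-- The pull-back `g ↦ g ∘ A` under a holomorphic map germ `A : (E', 0) → (E, 0)`. -/
def comp (A : E' → E) (hA : AnalyticAt ℂ A 0) (h0 : A 0 = 0) : HolGerm E →ₐ[ℂ] HolGerm E' where
  toFun g := ⟨(g : Germ (𝓝 (0 : E)) ℂ).compTendsto A
      (by simpa [ContinuousAt, h0] using hA.continuousAt), by
    obtain ⟨_, G, hG, rfl⟩ := g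
    exact ⟨G ∘ A, AnalyticAt.comp (by rwa [h0]) hA, rfl⟩⟩
  map_one' := rfl
  map_mul' := by
    rintro ⟨_, F, hF, rfl⟩ ⟨_, G, hG, rfl⟩
    rfl
  map_zero' := rfl
  map_add' := by
    rintro ⟨_, F, hF, rfl⟩ ⟨_, G, hG, rfl⟩
    rfl
  commutes' _ := rfl

theorem comp_of (A : E' → E) (hA : AnalyticAt ℂ A 0) (h0 : A 0 = 0) (G : E → ℂ)
    (hG : AnalyticAt ℂ G 0) :
    comp A hA h0 (of G hG) = of (G ∘ A) (AnalyticAt.comp (by rwa [h0]) hA) := rfl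

theorem valueHom_comp (A : E' → E) (hA : AnalyticAt ℂ A 0) (h0 : A 0 = 0) (g : HolGerm E) :
    valueHom (comp A hA h0 g) = valueHom g := by
  obtain ⟨G, hG, rfl⟩ := exists_of_eq g
  simp [comp_of, valueHom_of, h0]

/-! ### Hadamard's lemma -/

/-- Hadamard's lemma in coordinate-free form: the remainder of the constant term is linear with
analytic coefficients. It is obtained by freeing one argument in each term of the power series. -/
theorem _root_.AnalyticAt.exists_eventually_eq_add_apply {G : E → ℂ} (hG : AnalyticAt ℂ G 0) :
    ∃ Q : E → E →L[ℂ] ℂ, AnalyticAt ℂ Q 0 ∧ ∀ᶠ x in 𝓝 0, G x = G 0 + Q x x := by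
  obtain ⟨p, hp⟩ := hG
  have hr : 0 < p.shift.radius := by
    rw [FormalMultilinearSeries.radius_shift]
    exact hp.radius_pos
  have hQ := (p.shift.hasFPowerSeriesOnBall hr).hasFPowerSeriesAt
  refine ⟨_, hQ.analyticAt, ?_⟩
  filter_upwards [hp.eventually_hasSum, hQ.eventually_hasSum] with x h1 h2
  have h3 : HasSum (fun n => p (n + 1) fun _ => x) (G (0 + x) - p 0 fun _ => x) := by
    simpa using (hasSum_nat_add_iff' 1).2 h1
  have h4 := (ContinuousLinearMap.apply ℂ ℂ x).hasSum h2
  have h5 := h3.unique (h4.congr_fun fun n => ?_)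
  · rw [hp.coeff_zero] at h5
    simp only [zero_add, ContinuousLinearMap.apply_apply] at h5
    linear_combination h5
  · simp only [FormalMultilinearSeries.shift, ContinuousLinearMap.apply_apply,
      ContinuousMultilinearMap.curryRight_apply]
    congr 1
    ext i
    refine Fin.lastCases ?_ (fun i => ?_) i <;> simp

variable {m : ℕ}

theorem sum_of {ι : Type*} (s : Finset ι) (F : ι → E → ℂ) (hF : ∀ i, AnalyticAt ℂ (F i) 0) :
    ∑ i ∈ s, of (F i) (hF i) =
      of (fun x => ∑ i ∈ s, F i x) (s.analyticAt_fun_sum fun i _ => hF i) := by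
  classical
  induction s using Finset.induction_on with
  | empty =>
    refine Eq.trans (b := of (fun _ => 0) analyticAt_const) rfl ?_
    exact of_eq_of_iff.2 (Eventually.of_forall fun x => by simp)
  | insert a s ha ih =>
    rw [Finset.sum_insert ha, ih, of_add_of]
    exact of_eq_of_iff.2 (Eventually.of_forall fun x => by simp [Finset.sum_insert ha])

theorem analyticAt_coord (i : Fin m) (a : Fin m → ℂ) :
    AnalyticAt ℂ (fun x : Fin m → ℂ => x i) a :=
  (ContinuousLinearMap.proj (R := ℂ) (φ := fun _ : Fin m => ℂ) i).analyticAt a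

/-- The germ of the `i`-th coordinate function. -/
def coord (i : Fin m) : HolGerm (Fin m → ℂ) := of (fun x => x i) (analyticAt_coord i 0)

theorem coord_mem_maximalIdeal (i : Fin m) :
    coord i ∈ IsLocalRing.maximalIdeal (HolGerm (Fin m → ℂ)) := by
  rw [mem_maximalIdeal_iff_valueHom, coord, valueHom_of]
  rfl

/-- The maximal ideal of the ring of germs is generated by the coordinate functions. -/
theorem maximalIdeal_eq_span_coord :
    IsLocalRing.maximalIdeal (HolGerm (Fin m → ℂ)) = Ideal.span (Set.range coord) := by
  apply le_antisymm
  · intro g hg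
    obtain ⟨G, hG, rfl⟩ := exists_of_eq g
    rw [mem_maximalIdeal_iff_valueHom, valueHom_of] at hg
    obtain ⟨Q, hQ, h⟩ := hG.exists_eventually_eq_add_apply
    have hq (i : Fin m) : AnalyticAt ℂ (fun x => Q x (Pi.single i 1)) 0 :=
      (ContinuousLinearMap.apply ℂ ℂ (Pi.single i 1 : Fin m → ℂ)).analyticAt _ |>.comp hQ
    have : of G hG = ∑ i, of _ (hq i) * coord i := by
      refine Eq.trans ?_ (sum_of Finset.univ _ fun i => (hq i).fun_mul (analyticAt_coord i 0)).symm
      apply of_eq_of_iff.2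
      filter_upwards [h] with x hx
      rw [hx, hg, zero_add]
      nth_rw 2 [← Finset.univ_sum_single x]
      rw [map_sum]
      refine Finset.sum_congr rfl fun i _ => ?_
      rw [mul_comm (Q x _), ← smul_eq_mul, ← map_smul, ← Pi.single_smul, smul_eq_mul, mul_one]
    rw [this]
    exact Ideal.sum_mem _ fun i _ => Ideal.mul_mem_left _ _ (Ideal.subset_span ⟨i, rfl⟩)
  · rw [Ideal.span_le]
    rintro _ ⟨i, rfl⟩
    exact coord_mem_maximalIdeal i

/-! ### Leading forms -/

/-- The germ at the origin of a polynomial function. -/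
def ofPoly : MvPolynomial (Fin m) ℂ →ₐ[ℂ] HolGerm (Fin m → ℂ) := MvPolynomial.aeval coord

theorem _root_.MvPolynomial.analyticAt_eval (P : MvPolynomial (Fin m) ℂ) (a : Fin m → ℂ) :
    AnalyticAt ℂ (fun x => MvPolynomial.eval x P) a := by
  simpa [MvPolynomial.aeval_eq_eval] using
    AnalyticAt.aeval_mvPolynomial (f := fun x : Fin m → ℂ => x) (z := a) (fun i =>
      HolGerm.analyticAt_coord i a) P

theorem ofPoly_eq (P : MvPolynomial (Fin m) ℂ) :
    ofPoly P = of (fun x => MvPolynomial.eval x P) (P.analyticAt_eval 0) := by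
  induction P using MvPolynomial.induction_on with
  | C a =>
    rw [ofPoly, MvPolynomial.aeval_C, algebraMap_eq_of]
    apply of_eq_of_iff.2
    exact Eventually.of_forall fun x => by simp
  | add P Q hP hQ =>
    rw [map_add, hP, hQ, of_add_of]
    exact of_eq_of_iff.2 (Eventually.of_forall fun x => by simp)
  | mul_X P i hP =>
    rw [map_mul, hP, show ofPoly (MvPolynomial.X i) = coord i from MvPolynomial.aeval_X _ _,
      coord, of_mul_of]
    exact of_eq_of_iff.2 (Eventually.of_forall fun x => by simp)

theorem ofPoly_mem_pow {P : MvPolynomial (Fin m) ℂ} {k : ℕ} (hP : P.IsHomogeneous k) :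
    ofPoly P ∈ IsLocalRing.maximalIdeal (HolGerm (Fin m → ℂ)) ^ k := by
  rw [maximalIdeal_eq_span_coord, Ideal.mem_span_pow_iff_exists_isHomogeneous]
  exact ⟨_, hP.map (algebraMap ℂ _), by rw [MvPolynomial.eval_map]; rfl⟩

/-- `IsLeadingForm g P k` says that `P` is the homogeneous component of degree `k` of the germ `g`,
all components of smaller degree being zero. The form `P` itself is allowed to be zero. -/
structure IsLeadingForm (g : HolGerm (Fin m → ℂ)) (P : MvPolynomial (Fin m) ℂ) (k : ℕ) : Prop where
  isHomogeneous : P.IsHomogeneous k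
  sub_mem : g - ofPoly P ∈ IsLocalRing.maximalIdeal (HolGerm (Fin m → ℂ)) ^ (k + 1)

/-- The constant terms of the coefficients in an expression of `g` as a form of degree `k` in the
coordinates make up the leading form of `g`. -/
theorem exists_isLeadingForm {g : HolGerm (Fin m → ℂ)} {k : ℕ}
    (hg : g ∈ IsLocalRing.maximalIdeal (HolGerm (Fin m → ℂ)) ^ k) :
    ∃ P, IsLeadingForm g P k := by
  have hg' := hg
  rw [maximalIdeal_eq_span_coord, Ideal.mem_span_pow_iff_exists_isHomogeneous] at hg'
  obtain ⟨p, hp, rfl⟩ := hg'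
  refine ⟨p.map valueHom.toRingHom, hp.map _, ?_⟩
  -- Coefficientwise, `p` differs from its constant terms by germs in the maximal ideal.
  have h1 : ofPoly (p.map valueHom.toRingHom) = MvPolynomial.eval coord
      ((p.map valueHom.toRingHom).map (algebraMap ℂ (HolGerm (Fin m → ℂ)))) := by
    rw [MvPolynomial.eval_map]; rfl
  rw [h1, ← map_sub]
  set q := p - (p.map valueHom.toRingHom).map (algebraMap ℂ (HolGerm (Fin m → ℂ))) with hq
  have hqh : q.IsHomogeneous k := hp.sub ((hp.map _).map _)
  rw [MvPolynomial.eval_eq]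
  refine Ideal.sum_mem _ fun e he => ?_
  rw [pow_succ']
  apply Ideal.mul_mem_mul
  · rw [hq, MvPolynomial.coeff_sub, MvPolynomial.coeff_map, MvPolynomial.coeff_map]
    exact sub_algebraMap_valueHom_mem _
  · have h2 := hqh.degree_eq_sum_deg_support he
    rw [h2, ← Finset.prod_pow_eq_pow_sum]
    exact Ideal.prod_mem_prod fun i _ => Ideal.pow_mem_pow (coord_mem_maximalIdeal i) _

/-! ### Orders along curves -/

/-- The coordinate germ on the line. -/
def var : HolGerm ℂ := of id analyticAt_id

theorem order_var : order var = 1 := analyticOrderAt_id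

theorem order_one : order 1 = 0 :=
  (analyticOrderAt_eq_zero (f := fun _ : ℂ => (1 : ℂ))).2 (Or.inr one_ne_zero)

theorem order_pow (g : HolGerm ℂ) (k : ℕ) : order (g ^ k) = k * order g := by
  induction k with
  | zero => simp [order_one]
  | succ k ih => rw [pow_succ, order_mul, ih]; push_cast; ring

theorem order_eq_zero_iff (g : HolGerm ℂ) : order g = 0 ↔ valueHom g ≠ 0 := by
  obtain ⟨G, hG, rfl⟩ := exists_of_eq g
  exact hG.analyticOrderAt_eq_zero

theorem one_le_order_iff (g : HolGerm ℂ) : 1 ≤ order g ↔ valueHom g = 0 := by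
  rw [Order.one_le_iff_ne_zero, ne_eq, order_eq_zero_iff, not_not]

theorem order_var_pow_mul (k : ℕ) {g : HolGerm ℂ} (hg : valueHom g ≠ 0) :
    order (var ^ k * g) = k := by
  rw [order_mul, order_pow, order_var, (order_eq_zero_iff g).2 hg, mul_one, add_zero]

/-- The ideal of elements whose image under `φ` in the germs on the line has order at least `k`. -/
def orderIdeal {R : Type*} [CommRing R] (φ : R →+* HolGerm ℂ) (k : ℕ) : Ideal R where
  carrier := {g | (k : ℕ∞) ≤ order (φ g)}
  add_mem' {a b} ha hb := by
    change _ ≤ order _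
    rw [map_add]
    exact (le_min ha hb).trans (min_order_le_order_add _ _)
  zero_mem' := by
    change _ ≤ order _
    rw [map_zero, order_zero]
    exact le_top
  smul_mem' c x hx := by
    change _ ≤ order _
    rw [smul_eq_mul, map_mul, order_mul]
    exact le_add_left hx

theorem mem_orderIdeal {R : Type*} [CommRing R] {φ : R →+* HolGerm ℂ} {k : ℕ} {g : R} :
    g ∈ orderIdeal φ k ↔ (k : ℕ∞) ≤ order (φ g) := Iff.rfl

theorem pow_le_orderIdeal {R : Type*} [CommRing R] {φ : R →+* HolGerm ℂ} {I : Ideal R}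
    (hI : I ≤ orderIdeal φ 1) (k : ℕ) : I ^ k ≤ orderIdeal φ k := by
  induction k with
  | zero => exact fun g _ => by simp [mem_orderIdeal]
  | succ k ih =>
    rw [pow_succ, Ideal.mul_le]
    intro r hr s hs
    rw [mem_orderIdeal, map_mul, order_mul, Nat.cast_add]
    exact add_le_add (ih hr) (hI hs)

variable {E : Type*} [NormedAddCommGroup E] [NormedSpace ℂ E]

/-- Orders along curves are bounded below by the order with respect to the maximal ideal. -/
theorem le_order_comp {φ : ℂ → E} {hφ : AnalyticAt ℂ φ 0} {h0 : φ 0 = 0} {g : HolGerm E} {k : ℕ}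
    (hg : g ∈ IsLocalRing.maximalIdeal (HolGerm E) ^ k) : k ≤ order (comp φ hφ h0 g) :=
  pow_le_orderIdeal (φ := (comp φ hφ h0).toRingHom) (fun g hg => by
    rw [mem_orderIdeal, Nat.cast_one, one_le_order_iff]
    exact (valueHom_comp _ _ _ _).trans ((mem_maximalIdeal_iff_valueHom g).1 hg)) k hg

variable {m : ℕ}

theorem _root_.MvPolynomial.IsHomogeneous.eval_smul_eq_pow_mul {P : MvPolynomial (Fin m) ℂ} {k : ℕ}
    (hP : P.IsHomogeneous k) (t : ℂ) (p : Fin m → ℂ) :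
    MvPolynomial.eval (t • p) P = t ^ k * MvPolynomial.eval p P := by
  simp only [MvPolynomial.eval_eq, Finset.mul_sum]
  refine Finset.sum_congr rfl fun e he => ?_
  rw [hP.degree_eq_sum_deg_support he, ← Finset.prod_pow_eq_pow_sum]
  simp only [Pi.smul_apply, smul_eq_mul, mul_pow, Finset.prod_mul_distrib]
  ring

/-- The pull-back of germs to the line through `p`. -/
def compLine (p : Fin m → ℂ) : HolGerm (Fin m → ℂ) →ₐ[ℂ] HolGerm ℂ :=
  comp (fun t : ℂ => t • p) (analyticAt_id.smul analyticAt_const) (zero_smul _ _)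

theorem compLine_ofPoly (p : Fin m → ℂ) {P : MvPolynomial (Fin m) ℂ} {k : ℕ}
    (hP : P.IsHomogeneous k) :
    compLine p (ofPoly P) = var ^ k * algebraMap ℂ _ (MvPolynomial.eval p P) := by
  rw [ofPoly_eq, compLine, comp_of]
  have : var ^ k = of (fun t => t ^ k) (analyticAt_id.pow k) := rfl
  rw [this, algebraMap_eq_of, of_mul_of]
  exact of_eq_of_iff.2 (Eventually.of_forall fun t => hP.eval_smul_eq_pow_mul t p)

/-- A homogeneous polynomial of degree `k` whose germ has order greater than `k` along every line
vanishes. -/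
theorem eq_zero_of_forall_lt_order_compLine {P : MvPolynomial (Fin m) ℂ} {k : ℕ}
    (hP : P.IsHomogeneous k) (h : ∀ p, ((k + 1 : ℕ) : ℕ∞) ≤ order (compLine p (ofPoly P))) :
    P = 0 := by
  refine MvPolynomial.funext fun p => ?_
  rw [map_zero]
  by_contra hp
  have := h p
  rw [compLine_ofPoly p hP, order_var_pow_mul k (by simpa using hp), Nat.cast_le] at this
  omega

/-! ### Homogeneous expansions -/

/-- A convergent power series in one variable without terms of degree less than `k` has order at
least `k`. -/
theorem le_analyticOrderAt_of_hasSum {u : ℂ → ℂ} {a : ℕ → ℂ} {k : ℕ}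
    (hu : ∀ᶠ t in 𝓝 0, HasSum (fun j => t ^ j * a j) (u t)) (ha : ∀ j < k, a j = 0) :
    (k : ℕ∞) ≤ analyticOrderAt u 0 := by
  let p : FormalMultilinearSeries ℂ ℂ ℂ :=
    fun j => ContinuousMultilinearMap.mkPiRing ℂ (Fin j) (a j)
  let q : FormalMultilinearSeries ℂ ℂ ℂ :=
    fun j => ContinuousMultilinearMap.mkPiRing ℂ (Fin j) (a (j + k))
  have hp : HasFPowerSeriesAt u p 0 := by
    rw [hasFPowerSeriesAt_iff]
    simpa [p, FormalMultilinearSeries.coeff] using hu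
  let w : ℂ → ℂ := fun t => ∑' j, t ^ j * a (j + k)
  have hw : ∀ᶠ t in 𝓝 0, HasSum (fun j => t ^ j * a (j + k)) (w t) ∧ u t = t ^ k * w t := by
    filter_upwards [hu] with t ht
    have h1 : HasSum (fun j => t ^ (j + k) * a (j + k)) (u t) := by
      have := (hasSum_nat_add_iff' k).2 ht
      rwa [Finset.sum_eq_zero (fun j hj => by rw [ha j (Finset.mem_range.1 hj), mul_zero]),
        sub_zero] at this
    have h2 : Summable fun j => t ^ j * a (j + k) := by
      rcases eq_or_ne t 0 with rfl | h0
      · exact summable_of_ne_finset_zero (s := {0}) fun j hj => by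
          simp [zero_pow (Finset.notMem_singleton.1 hj)]
      · refine (h1.summable.mul_left (t ^ k)⁻¹).congr fun j => ?_
        rw [pow_add]
        field_simp
    refine ⟨h2.hasSum, h1.unique ((h2.hasSum.mul_left (t ^ k)).congr_fun fun j => ?_)⟩
    ring
  have hq : HasFPowerSeriesAt w q 0 := by
    rw [hasFPowerSeriesAt_iff]
    filter_upwards [hw] with t ht
    simpa [q, FormalMultilinearSeries.coeff] using ht.1
  rw [natCast_le_analyticOrderAt hp.analyticAt]
  refine ⟨w, hq.analyticAt, ?_⟩
  filter_upwards [hw] with t ht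
  simpa using ht.2

theorem IsHomogeneousExpansion.isLeadingForm_of_mem_pow {g : HolGerm (Fin m → ℂ)}
    {F : ℕ → MvPolynomial (Fin m) ℂ} (hF : IsHomogeneousExpansion g F) {k : ℕ}
    (hlow : ∀ j < k, F j = 0) (hg : g ∈ IsLocalRing.maximalIdeal (HolGerm (Fin m → ℂ)) ^ k) :
    IsLeadingForm g (F k) k := by
  refine ⟨hF.1 k, ?_⟩
  obtain ⟨P, hP, hgP⟩ := exists_isLeadingForm hg
  suffices h : P - F k = 0 by rwa [← sub_eq_zero.1 h]
  refine eq_zero_of_forall_lt_order_compLine (hP.sub (hF.1 k)) fun p => ?_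
  -- Along a line, both `P` and `F k` are the coefficient of degree `k` of the restriction of `g`.
  have h1 : ((k + 1 : ℕ) : ℕ∞) ≤ order (compLine p (ofPoly P - g)) :=
    le_order_comp (by rw [← neg_sub]; exact neg_mem hgP)
  have h2 : ((k + 1 : ℕ) : ℕ∞) ≤ order (compLine p (g - ofPoly (F k))) := by
    obtain ⟨hhom, G', hG', hsum⟩ := hF
    obtain ⟨G, hG, rfl⟩ := exists_of_eq g
    have hGG' : G =ᶠ[𝓝 0] G' := Germ.coe_eq.1 hG'
    have hline : Tendsto (fun t : ℂ => t • p) (𝓝 0) (𝓝 0) := by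
      have : ContinuousAt (fun t : ℂ => t • p) 0 := by fun_prop
      simpa [ContinuousAt] using this
    rw [map_sub, compLine_ofPoly p (hhom k)]
    -- The power series of the restriction, with the term of degree `k` removed.
    let a : ℕ → ℂ := fun j => if j = k then 0 else MvPolynomial.eval p (F j)
    refine le_analyticOrderAt_of_hasSum (a := a)
      (u := fun t => G (t • p) - t ^ k * MvPolynomial.eval p (F k)) ?_ fun j hj => ?_
    · filter_upwards [hline.eventually hGG', hline.eventually hsum] with t h1 h2
      have h3 := h2.sub (hasSum_ite_eq k (t ^ k * MvPolynomial.eval p (F k)))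
      rw [h1]
      refine h3.congr_fun fun j => ?_
      rw [(hhom j).eval_smul_eq_pow_mul]
      by_cases hj : j = k
      · simp [a, hj]
      · simp [a, hj]
    · rcases Nat.lt_succ_iff_lt_or_eq.1 hj with h | h
      · simp [a, hlow j h]
      · simp [a, h]
  rw [map_sub, ← sub_add_sub_cancel _ g, map_add]
  exact (le_min h1 h2).trans (min_order_le_order_add _ _)

/-- The first term of a homogeneous expansion is the leading form with respect to the powers of
the maximal ideal. -/
theorem IsHomogeneousExpansion.isLeadingForm {g : HolGerm (Fin m → ℂ)}
    {F : ℕ → MvPolynomial (Fin m) ℂ} (hF : IsHomogeneousExpansion g F) {d : ℕ}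
    (hlow : ∀ j < d, F j = 0) : IsLeadingForm g (F d) d := by
  refine hF.isLeadingForm_of_mem_pow hlow ?_
  suffices h : ∀ k ≤ d, g ∈ IsLocalRing.maximalIdeal (HolGerm (Fin m → ℂ)) ^ k from h d le_rfl
  intro k hk
  induction k with
  | zero => simp
  | succ k ih =>
    simpa [hlow k hk] using
      (hF.isLeadingForm_of_mem_pow (fun j hj => hlow j (hj.trans hk)) (ih (by omega))).sub_mem

/-! ### Arcs with a prescribed tangent direction -/

/-- The germ of the first coordinate function of `ℂ × ℂ`. -/
def fst : HolGerm (ℂ × ℂ) := of Prod.fst analyticAt_fst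

/-- The blow-up chart `(t, s) ↦ t (p + s v)`. -/
def chart (p v : Fin m → ℂ) (x : ℂ × ℂ) : Fin m → ℂ := x.1 • (p + x.2 • v)

theorem analyticAt_chart (p v : Fin m → ℂ) (x : ℂ × ℂ) : AnalyticAt ℂ (chart p v) x :=
  analyticAt_fst.smul (analyticAt_const.add (analyticAt_snd.smul analyticAt_const))

theorem chart_zero (p v : Fin m → ℂ) : chart p v 0 = 0 := by simp [chart]

/-- The pull-back of germs to the chart `(t, s) ↦ t (p + s v)`. -/
def compChart (p v : Fin m → ℂ) : HolGerm (Fin m → ℂ) →ₐ[ℂ] HolGerm (ℂ × ℂ) :=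
  comp (chart p v) (analyticAt_chart p v 0) (chart_zero p v)

/-- The coordinates `x_i` become `t (p_i + s v_i)` in the chart, so `𝔪 ^ k` lands in `(t ^ k)`. -/
theorem fst_pow_dvd_compChart (p v : Fin m → ℂ) {g : HolGerm (Fin m → ℂ)} {k : ℕ}
    (hg : g ∈ IsLocalRing.maximalIdeal (HolGerm (Fin m → ℂ)) ^ k) :
    fst ^ k ∣ compChart p v g := by
  rw [← Ideal.mem_span_singleton, ← Ideal.span_singleton_pow]
  have h1 : Ideal.map (compChart p v) (IsLocalRing.maximalIdeal (HolGerm (Fin m → ℂ))) ≤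
      Ideal.span {fst} := by
    rw [maximalIdeal_eq_span_coord, Ideal.map_span, Ideal.span_le]
    rintro _ ⟨_, ⟨i, rfl⟩, rfl⟩
    have h : AnalyticAt ℂ (fun x : ℂ × ℂ => p i + x.2 * v i) 0 :=
      analyticAt_const.add (analyticAt_snd.mul analyticAt_const)
    exact Ideal.mem_span_singleton.2 ⟨of _ h, rfl⟩
  have h2 := Ideal.mem_map_of_mem (compChart p v) hg
  rw [Ideal.map_pow] at h2
  exact Ideal.pow_right_mono h1 k h2

theorem analyticAt_eval_add_smul (P : MvPolynomial (Fin m) ℂ) (p v : Fin m → ℂ) (x : ℂ × ℂ) :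
    AnalyticAt ℂ (fun x : ℂ × ℂ => MvPolynomial.eval (p + x.2 • v) P) x :=
  (P.analyticAt_eval _).comp (f := fun x : ℂ × ℂ => p + x.2 • v)
    (analyticAt_const.add (analyticAt_snd.smul analyticAt_const))

/-- The germ `(t, s) ↦ P (p + s v)`. -/
def evalChart (P : MvPolynomial (Fin m) ℂ) (p v : Fin m → ℂ) : HolGerm (ℂ × ℂ) :=
  of (fun x : ℂ × ℂ => MvPolynomial.eval (p + x.2 • v) P) (analyticAt_eval_add_smul P p v 0)

/-- The strict transform in the chart `(t, s) ↦ t (p + s v)` of a germ with leading form `P`. -/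
theorem exists_compChart_eq (p v : Fin m → ℂ) {g : HolGerm (Fin m → ℂ)}
    {P : MvPolynomial (Fin m) ℂ} {k : ℕ} (hg : IsLeadingForm g P k) :
    ∃ r : HolGerm (ℂ × ℂ), compChart p v g = fst ^ k * (evalChart P p v + fst * r) := by
  obtain ⟨r, hr⟩ := fst_pow_dvd_compChart p v hg.sub_mem
  refine ⟨r, ?_⟩
  rw [map_sub, sub_eq_iff_eq_add'] at hr
  rw [hr, mul_add, pow_succ, mul_assoc]
  congr 1
  rw [ofPoly_eq, compChart, comp_of]
  have : fst ^ k = of (fun x : ℂ × ℂ => x.1 ^ k) (analyticAt_fst.pow k) := rfl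
  rw [this, evalChart, of_mul_of]
  exact of_eq_of_iff.2 (Eventually.of_forall fun x => hg.isHomogeneous.eval_smul_eq_pow_mul _ _)

/-- The implicit function theorem for a germ in two variables. -/
theorem _root_.AnalyticAt.exists_analyticAt_eventually_eq_zero {H : ℂ × ℂ → ℂ}
    (hH : AnalyticAt ℂ H 0) (h0 : H 0 = 0) (h' : deriv (fun s => H (0, s)) 0 ≠ 0) :
    ∃ s : ℂ → ℂ, AnalyticAt ℂ s 0 ∧ s 0 = 0 ∧ ∀ᶠ t in 𝓝 0, H (t, s t) = 0 := by
  have hc : ContDiffAt ℂ ⊤ H 0 := hH.contDiffAt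
  have hd : HasDerivAt (fun s => H (0, s)) (fderiv ℂ H 0 (0, 1)) 0 :=
    hH.differentiableAt.hasFDerivAt.comp_hasDerivAt (f := fun s : ℂ => ((0 : ℂ), s)) 0
      ((hasDerivAt_const 0 0).prodMk (hasDerivAt_id 0))
  rw [hd.deriv] at h'
  have hinv : (fderiv ℂ H 0 ∘L .inr ℂ ℂ ℂ).IsInvertible := by
    refine ⟨ContinuousLinearEquiv.unitsEquivAut ℂ (Units.mk0 _ h'), ?_⟩
    ext
    simp
  refine ⟨hc.implicitFunction (by simp) hinv, ?_, hc.implicitFunction_apply_self _ _, ?_⟩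
  · exact (hc.contDiffAt_implicitFunction (by simp) hinv).analyticAt
  · simpa [h0] using hc.eventually_apply_implicitFunction (by simp) hinv

end HolGerm

/-! ### Smooth points of a reduced hypersurface -/

namespace MvPolynomial

variable {σ : Type*}

theorem totalDegree_pderiv_lt {R : Type*} [CommSemiring R] {q : MvPolynomial σ R} {j : σ}
    (h : pderiv j q ≠ 0) : (pderiv j q).totalDegree < q.totalDegree := by
  obtain ⟨e, he, hdeg⟩ := Finset.exists_mem_eq_sup _ (support_nonempty.2 h) fun s => s.degree
  have h1 : (pderiv j q).totalDegree = e.degree := hdeg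
  have h2 : e + Finsupp.single j 1 ∈ q.support := by
    rw [mem_support_iff, coeff_pderiv] at *
    exact left_ne_zero_of_mul he
  have h3 : (e + Finsupp.single j 1).degree ≤ q.totalDegree := le_totalDegree h2
  rw [h1]
  simp at h3
  omega

variable {K : Type*} [Field K] [CharZero K]

/-- In characteristic zero an irreducible polynomial does not divide all its derivatives. -/
theorem _root_.Irreducible.exists_not_dvd_pderiv {q : MvPolynomial σ K} (hq : Irreducible q) :
    ∃ j, ¬ q ∣ pderiv j q := by
  by_contra! h
  have h0 (j : σ) : pderiv j q = 0 := by
    by_contra hj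
    exact (totalDegree_pderiv_lt hj).not_ge (totalDegree_le_of_dvd_of_isDomain (h j) hj)
  have hC : q = C (coeff 0 q) := by
    classical
    ext e
    rw [coeff_C]
    split_ifs with he
    · rw [he]
    · obtain ⟨j, hj⟩ : ∃ j, e j ≠ 0 := by
        by_contra! h
        exact he (Finsupp.ext fun j => (h j).symm)
      have h1 := congrArg (coeff (e - Finsupp.single j 1)) (h0 j)
      rw [coeff_pderiv, coeff_zero, tsub_add_cancel_of_le
        (Finsupp.single_le_iff.2 (Nat.one_le_iff_ne_zero.2 hj))] at h1
      exact (mul_eq_zero.1 h1).resolve_right (Nat.cast_add_one_ne_zero _)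
  apply hq.not_isUnit
  rw [hC]
  refine (isUnit_iff_ne_zero.2 fun h => hq.ne_zero ?_).map C
  rw [hC, h, C_0]

/-- A non-zero square-free element divides everything its irreducible factors divide. -/
theorem _root_.Squarefree.dvd_of_forall_irreducible {R : Type*} [CommMonoidWithZero R]
    [UniqueFactorizationMonoid R] {F P : R} (hF : Squarefree F) (hF0 : F ≠ 0)
    (h : ∀ q, Irreducible q → q ∣ F → q ∣ P) : F ∣ P := by
  induction F using UniqueFactorizationMonoid.induction_on_prime with
  | h₁ => exact absurd rfl hF0
  | h₂ u hu => exact hu.dvd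
  | h₃ a q ha hq ih =>
    refine (IsRelPrime.of_squarefree_mul hF).mul_dvd (h q hq.irreducible (dvd_mul_right _ _)) ?_
    exact ih (hF.squarefree_of_dvd (dvd_mul_left _ _)) ha fun r hr hra =>
      h r hr (hra.mul_left _)

/-- No irreducible factor `q` of a square-free `F = q a` divides all partial derivatives of `F`, as
`∂F ≡ a ∂q` modulo `q`. So `F` divides `P` as soon as it divides all products `P * ∂F`. -/
theorem _root_.Squarefree.dvd_of_forall_dvd_mul_pderiv {F P : MvPolynomial σ K}
    (hF : Squarefree F) (hF0 : F ≠ 0) (h : ∀ j, F ∣ P * pderiv j F) : F ∣ P := by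
  refine hF.dvd_of_forall_irreducible hF0 fun q hq ⟨a, ha⟩ => ?_
  obtain ⟨j, hj⟩ := hq.exists_not_dvd_pderiv
  have hqa : ¬ q ∣ a := fun ⟨b, hb⟩ => hq.not_isUnit (hF q ⟨b, by rw [ha, hb, mul_assoc]⟩)
  have h1 : q ∣ P * pderiv j F := (Dvd.intro _ ha.symm).trans (h j)
  refine (hq.prime.dvd_or_dvd h1).resolve_right fun h2 => ?_
  rw [ha, pderiv_mul] at h2
  exact (hq.prime.dvd_or_dvd ((dvd_add_left (dvd_mul_right _ _)).1 h2)).elim hj hqa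

end MvPolynomial

open MvPolynomial in
/-- If `P` does not vanish on the reduced hypersurface `F = 0`, it does not vanish at some smooth
point of it. -/
theorem exists_eval_ne_zero {m : ℕ} {F P : MvPolynomial (Fin m) ℂ} (hF0 : F ≠ 0)
    (hF : IsReduced (ConeRing F)) (hP : ¬ F ∣ P) :
    ∃ p j, eval p F = 0 ∧ eval p P ≠ 0 ∧ eval p (pderiv j F) ≠ 0 := by
  by_contra! h
  have hrad : (Ideal.span {F}).IsRadical := (Ideal.isRadical_iff_quotient_reduced _).2 hF
  have hsq : Squarefree F := (isRadical_iff_span_singleton.2 hrad).squarefree hF0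
  refine hP (hsq.dvd_of_forall_dvd_mul_pderiv hF0 fun j => ?_)
  rw [← Ideal.mem_span_singleton, ← hrad.radical, ← vanishingIdeal_zeroLocus_eq_radical (K := ℂ)]
  intro p hp
  have hp' : eval p F = 0 := by
    simpa [aeval_eq_eval] using hp F (Ideal.mem_span_singleton_self F)
  by_cases hPp : eval p P = 0
  · simp [aeval_eq_eval, hPp]
  · simp [aeval_eq_eval, h p j hp' hPp]

/-! ### Arcs through smooth points of the tangent cone -/

theorem MvPolynomial.hasDerivAt_eval_add_smul_single {m : ℕ} (P : MvPolynomial (Fin m) ℂ)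
    (p : Fin m → ℂ) (j : Fin m) :
    HasDerivAt (fun s : ℂ => MvPolynomial.eval (p + s • Pi.single j 1) P)
      (MvPolynomial.eval p (MvPolynomial.pderiv j P)) 0 := by
  induction P using MvPolynomial.induction_on with
  | C a => simpa using hasDerivAt_const (0 : ℂ) a
  | add P Q hP hQ => simpa using hP.fun_add hQ
  | mul_X P i hP =>
    have hX : HasDerivAt (fun s : ℂ => (p + s • (Pi.single j 1 : Fin m → ℂ)) i)
        ((Pi.single j 1 : Fin m → ℂ) i) 0 := by
      simpa using ((hasDerivAt_id (0 : ℂ)).mul_const ((Pi.single j 1 : Fin m → ℂ) i)).const_add (p i)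
    have h := hP.mul hX
    simp only [zero_smul, add_zero] at h
    refine (h.congr_deriv ?_).congr_of_eventuallyEq (Eventually.of_forall fun s => by simp)
    rw [MvPolynomial.pderiv_mul, MvPolynomial.pderiv_X, map_add, map_mul, map_mul,
      MvPolynomial.eval_X]
    congr 2
    by_cases hij : i = j
    · subst hij; simp
    · simp [hij]

namespace HolGerm

variable {m : ℕ}

theorem valueHom_evalChart_add (P : MvPolynomial (Fin m) ℂ) (p v : Fin m → ℂ)
    (r : HolGerm (ℂ × ℂ)) : valueHom (evalChart P p v + fst * r) = MvPolynomial.eval p P := by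
  rw [map_add, map_mul, evalChart, valueHom_of, fst, valueHom_of]
  simp

end HolGerm

open HolGerm

/-- Every smooth point `p` of the tangent cone is the derivative at `0` of an arc on `V`. The order
along this arc of a germ whose leading form does not vanish at `p` is the degree of that form. -/
theorem exists_arc_forall_order_eq {m : ℕ} (f : IsLocalRing.maximalIdeal (HolGerm (Fin m → ℂ)))
    {F : MvPolynomial (Fin m) ℂ} {d : ℕ} (hf : IsLeadingForm (f : HolGerm (Fin m → ℂ)) F d)
    {p : Fin m → ℂ} {j : Fin m} (hp : MvPolynomial.eval p F = 0)
    (hj : MvPolynomial.eval p (MvPolynomial.pderiv j F) ≠ 0) :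
    ∃ φ : Arc f, ∀ (g : HolGerm (Fin m → ℂ)) (P : MvPolynomial (Fin m) ℂ) (k : ℕ),
      IsLeadingForm g P k → MvPolynomial.eval p P ≠ 0 → φ.order (Ideal.Quotient.mk _ g) = k := by
  set v : Fin m → ℂ := Pi.single j 1 with hv
  obtain ⟨r, hr⟩ := exists_compChart_eq p v hf
  -- `H` is the strict transform of `f`, vanishing at the origin of the chart with `∂H/∂s ≠ 0`.
  obtain ⟨H, hH, hHr⟩ := exists_of_eq (evalChart F p v + fst * r)
  have hH0 : H 0 = 0 := by
    rw [← valueHom_of H hH, hHr, valueHom_evalChart_add, hp]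
  have hH' : deriv (fun s => H (0, s)) 0 ≠ 0 := by
    obtain ⟨R, hR, rfl⟩ := exists_of_eq r
    have h1 : H =ᶠ[𝓝 0] fun x => MvPolynomial.eval (p + x.2 • v) F + x.1 * R x :=
      Germ.coe_eq.1 (Subtype.ext_iff.1 hHr)
    have h2 : (fun s => H (0, s)) =ᶠ[𝓝 0] fun s => MvPolynomial.eval (p + s • v) F := by
      have hc : Tendsto (fun s : ℂ => ((0 : ℂ), s)) (𝓝 0) (𝓝 0) :=
        (by fun_prop : ContinuousAt (fun s : ℂ => ((0 : ℂ), s)) 0)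
      filter_upwards [hc.eventually h1] with s hs
      simpa using hs
    rwa [h2.deriv_eq, (F.hasDerivAt_eval_add_smul_single p j).deriv]
  obtain ⟨s, hs, hs0, hsH⟩ := hH.exists_analyticAt_eventually_eq_zero hH0 hH'
  have hσ : AnalyticAt ℂ (fun t => (t, s t)) 0 := analyticAt_id.prod hs
  have hσ0 : (fun t => (t, s t)) (0 : ℂ) = (0 : ℂ × ℂ) := by simp [hs0]
  let σ := comp (fun t => (t, s t)) hσ hσ0
  have hφ : AnalyticAt ℂ (fun t => chart p v (t, s t)) 0 :=
    (analyticAt_chart p v _).comp (f := fun t : ℂ => (t, s t)) hσ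
  have hφ0 : (fun t => chart p v (t, s t)) 0 = 0 := by simp [hs0, chart]
  have hcomp (g) : pullback _ hφ hφ0 g = σ (compChart p v g) := by
    obtain ⟨G, hG, rfl⟩ := exists_of_eq g
    rfl
  have hfst : σ fst = var := rfl
  refine ⟨⟨_, hφ, hφ0, ?_⟩, fun g P k hg hpP => ?_⟩
  · have : σ (of H hH) = 0 := Subtype.ext (Germ.coe_eq.2 hsH)
    rw [hcomp, hr, ← hHr, map_mul, this, mul_zero]
  · obtain ⟨r', hr'⟩ := exists_compChart_eq p v hg
    change order (pullback _ hφ hφ0 g) = k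
    rw [hcomp, hr', map_mul, map_pow, hfst]
    apply order_var_pow_mul
    rwa [valueHom_comp, valueHom_evalChart_add]

/-! ### Homogeneous polynomials -/

namespace MvPolynomial

variable {σ R : Type*} [CommRing R]

attribute [local instance] MvPolynomial.gradedAlgebra in
theorem IsHomogeneous.homogeneousComponent_mul {F : MvPolynomial σ R} {d : ℕ}
    (hF : F.IsHomogeneous d) (G : MvPolynomial σ R) (k : ℕ) :
    homogeneousComponent k (F * G) = if d ≤ k then F * homogeneousComponent (k - d) G else 0 := by
  simpa only [← decomposition.decompose'_apply] using!
    DirectSum.coe_decompose_mul_of_left_mem (homogeneousSubmodule σ R) (b := G) k hF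

theorem IsHomogeneous.exists_eq_mul {F P : MvPolynomial σ R} {d k : ℕ} (hF : F.IsHomogeneous d)
    (hP : P.IsHomogeneous k) (hdk : d ≤ k) (h : F ∣ P) :
    ∃ Q : MvPolynomial σ R, Q.IsHomogeneous (k - d) ∧ P = F * Q := by
  obtain ⟨Q, rfl⟩ := h
  refine ⟨_, homogeneousComponent_isHomogeneous (k - d) Q, ?_⟩
  rw [← homogeneousComponent_eq_self hP, hF.homogeneousComponent_mul, if_pos hdk]

theorem IsHomogeneous.eq_zero_of_dvd {F P : MvPolynomial σ R} {d k : ℕ} (hF : F.IsHomogeneous d)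
    (hP : P.IsHomogeneous k) (hdk : k < d) (h : F ∣ P) : P = 0 := by
  obtain ⟨Q, rfl⟩ := h
  rw [← homogeneousComponent_eq_self hP, hF.homogeneousComponent_mul, if_neg hdk.not_ge]

/-- The number of monomials of degree `k` in `n + 1` variables. -/
theorem finrank_homogeneousSubmodule_fin_succ {K : Type*} [Field K] (n k : ℕ) :
    Module.finrank K (homogeneousSubmodule (Fin (n + 1)) K k) = (n + k).choose n := by
  classical
  have hs : {e : Fin (n + 1) →₀ ℕ | e.degree = k} =
      (Finset.finsuppAntidiag (Finset.univ : Finset (Fin (n + 1))) k : Set _) := by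
    ext e
    simp [Finset.mem_finsuppAntidiag, Finsupp.degree_eq_sum]
  rw [homogeneousSubmodule_eq_finsupp_supported, hs,
    (AddMonoidAlgebra.supportedEquivFinsupp _).finrank_eq, Module.finrank_finsupp_self]
  simp only [Finset.coe_sort_coe, Fintype.card_coe, Finset.card_finsuppAntidiag_nat_eq_choose,
    Finset.card_univ, Fintype.card_fin]
  rw [show n + 1 + k - 1 = n + k by omega, Nat.choose_symm_add]

end MvPolynomial

theorem PowerSeries.mk_eq_one_sub_X_pow_mul {R : Type*} [CommRing R] {a c : ℕ → R} {d : ℕ}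
    (h : ∀ k, a k + (if d ≤ k then c (k - d) else 0) = c k) :
    PowerSeries.mk a = (1 - PowerSeries.X ^ d) * PowerSeries.mk c := by
  ext k
  rw [sub_mul, one_mul, map_sub, PowerSeries.coeff_X_pow_mul']
  simp only [PowerSeries.coeff_mk]
  rw [← h k, add_sub_cancel_right]

/-! ### Dimensions of subquotients -/

section Subquotients

variable {K V W : Type*} [Field K] [AddCommGroup V] [Module K V] [AddCommGroup W] [Module K W]
  {A B : Submodule K V} {h : W →ₗ[K] V}

/-- A linear map into `A` that is onto modulo `B` induces a surjection onto `A / (A ∩ B)`. -/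
theorem Submodule.exists_surjective_ker_eq_comap (hA : ∀ w, h w ∈ A)
    (hB : ∀ x ∈ A, ∃ w, x - h w ∈ B) :
    ∃ L : W →ₗ[K] A ⧸ B.submoduleOf A, Function.Surjective L ∧ LinearMap.ker L = B.comap h := by
  refine ⟨Submodule.mkQ _ ∘ₗ h.codRestrict A hA, fun y => ?_, ?_⟩
  · obtain ⟨⟨x, hx⟩, rfl⟩ := Submodule.mkQ_surjective _ y
    obtain ⟨w, hw⟩ := hB x hx
    refine ⟨w, ((Submodule.Quotient.eq _).2 ?_).symm⟩
    exact hw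
  · rw [LinearMap.ker_comp, Submodule.ker_mkQ]
    rfl

theorem Submodule.finite_quotient_submoduleOf [Module.Finite K W] (hA : ∀ w, h w ∈ A)
    (hB : ∀ x ∈ A, ∃ w, x - h w ∈ B) : Module.Finite K (A ⧸ B.submoduleOf A) := by
  obtain ⟨L, hL, -⟩ := Submodule.exists_surjective_ker_eq_comap hA hB
  exact Module.Finite.of_surjective L hL

theorem Submodule.finrank_quotient_submoduleOf_add [Module.Finite K W] (hA : ∀ w, h w ∈ A)
    (hB : ∀ x ∈ A, ∃ w, x - h w ∈ B) :
    Module.finrank K (A ⧸ B.submoduleOf A) + Module.finrank K (B.comap h) =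
      Module.finrank K W := by
  obtain ⟨L, hL, hker⟩ := Submodule.exists_surjective_ker_eq_comap hA hB
  rw [← hker, ← L.finrank_range_add_finrank_ker, LinearMap.range_eq_top.2 hL, finrank_top]

end Subquotients

/-! ### The arc filtration -/

section LeadingForms

variable {m : ℕ} (f : IsLocalRing.maximalIdeal (HolGerm (Fin m → ℂ)))

theorem LocalRingOf.maximalIdeal_eq_map :
    IsLocalRing.maximalIdeal (LocalRingOf f) =
      (IsLocalRing.maximalIdeal (HolGerm (Fin m → ℂ))).map (Ideal.Quotient.mk _) := by
  have hloc : IsLocalHom (Ideal.Quotient.mk (Ideal.span {(f : HolGerm (Fin m → ℂ))})) :=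
    .of_surjective _ Ideal.Quotient.mk_surjective
  have h := IsLocalRing.maximalIdeal_comap
    (Ideal.Quotient.mk (Ideal.span {(f : HolGerm (Fin m → ℂ))}))
  exact (Ideal.map_comap_of_surjective _ Ideal.Quotient.mk_surjective _).symm.trans
    (congrArg (Ideal.map _) h)

theorem LocalRingOf.mk_mem_maximalIdeal_pow {g : HolGerm (Fin m → ℂ)} {k : ℕ}
    (hg : g ∈ IsLocalRing.maximalIdeal (HolGerm (Fin m → ℂ)) ^ k) :
    (Ideal.Quotient.mk _ g : LocalRingOf f) ∈ IsLocalRing.maximalIdeal (LocalRingOf f) ^ k := by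
  rw [LocalRingOf.maximalIdeal_eq_map, ← Ideal.map_pow]
  exact Ideal.mem_map_of_mem _ hg

theorem LocalRingOf.exists_mk_eq_of_mem_pow {x : LocalRingOf f} {k : ℕ}
    (hx : x ∈ IsLocalRing.maximalIdeal (LocalRingOf f) ^ k) :
    ∃ g ∈ IsLocalRing.maximalIdeal (HolGerm (Fin m → ℂ)) ^ k, Ideal.Quotient.mk _ g = x := by
  rwa [LocalRingOf.maximalIdeal_eq_map, ← Ideal.map_pow,
    Ideal.mem_map_iff_of_surjective _ Ideal.Quotient.mk_surjective] at hx

theorem mem_arcFiltration_iff {g : LocalRingOf f} {i : ℕ} :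
    g ∈ arcFiltration f i ↔ ∀ φ : Arc f, (i : ℕ∞) ≤ φ.order g :=
  le_arcOrder_iff

theorem pow_le_arcFiltration (i : ℕ) :
    IsLocalRing.maximalIdeal (LocalRingOf f) ^ i ≤ arcFiltration f i := by
  intro x hx
  obtain ⟨g, hg, rfl⟩ := LocalRingOf.exists_mk_eq_of_mem_pow f hx
  exact (mem_arcFiltration_iff f).2 fun φ =>
    le_order_comp (hφ := φ.analyticAt) (h0 := φ.map_zero) hg

variable {f} {F : MvPolynomial (Fin m) ℂ} {d : ℕ}

/-- If `g` vanishes on all arcs to higher order than its leading form `P` suggests, then `P`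
vanishes on the tangent cone. -/
theorem dvd_of_mem_arcFiltration (hf : IsLeadingForm (f : HolGerm (Fin m → ℂ)) F d) (hF0 : F ≠ 0)
    (hred : IsReduced (ConeRing F)) {g : HolGerm (Fin m → ℂ)} {P : MvPolynomial (Fin m) ℂ} {k : ℕ}
    (hg : IsLeadingForm g P k) (harc : Ideal.Quotient.mk _ g ∈ arcFiltration f (k + 1)) :
    F ∣ P := by
  by_contra hFP
  obtain ⟨p, j, hp, hpP, hj⟩ := exists_eval_ne_zero hF0 hred hFP
  obtain ⟨φ, hφ⟩ := exists_arc_forall_order_eq f hf hp hj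
  have h := (mem_arcFiltration_iff f).1 harc φ
  rw [hφ g P k hg hpP, Nat.cast_le] at h
  omega

/-- A leading form divisible by that of `f` is removed by subtracting a multiple of `f`. -/
theorem mk_mem_pow_succ_of_dvd (hf : IsLeadingForm (f : HolGerm (Fin m → ℂ)) F d)
    {g : HolGerm (Fin m → ℂ)} {P : MvPolynomial (Fin m) ℂ} {k : ℕ}
    (hg : IsLeadingForm g P k) (h : F ∣ P) :
    (Ideal.Quotient.mk _ g : LocalRingOf f) ∈
      IsLocalRing.maximalIdeal (LocalRingOf f) ^ (k + 1) := by
  rcases lt_or_ge k d with hkd | hdk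
  · have h0 := hf.isHomogeneous.eq_zero_of_dvd hg.isHomogeneous hkd h
    apply LocalRingOf.mk_mem_maximalIdeal_pow
    simpa [h0] using hg.sub_mem
  · obtain ⟨Q, hQ, rfl⟩ := hf.isHomogeneous.exists_eq_mul hg.isHomogeneous hdk h
    have h1 := Ideal.mul_mem_mul (ofPoly_mem_pow hQ) hf.sub_mem
    rw [← pow_add, ← add_assoc, Nat.sub_add_cancel hdk] at h1
    have h2 := LocalRingOf.mk_mem_maximalIdeal_pow f (sub_mem hg.sub_mem h1)
    rwa [show g - ofPoly (F * Q) - ofPoly Q * (f - ofPoly F) = g - ofPoly Q * f by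
      rw [map_mul]; ring, map_sub, map_mul, Ideal.Quotient.mk_singleton_self, mul_zero,
      sub_zero] at h2

/-- If the tangent cone is reduced, the arc filtration is the filtration by the powers of the
maximal ideal. -/
theorem arcFiltration_eq_pow (hf : IsLeadingForm (f : HolGerm (Fin m → ℂ)) F d) (hF0 : F ≠ 0)
    (hred : IsReduced (ConeRing F)) (i : ℕ) :
    arcFiltration f i = IsLocalRing.maximalIdeal (LocalRingOf f) ^ i := by
  refine le_antisymm (fun x hx => ?_) (pow_le_arcFiltration f i)
  suffices h : ∀ k ≤ i, x ∈ IsLocalRing.maximalIdeal (LocalRingOf f) ^ k from h i le_rfl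
  intro k hk
  induction k with
  | zero => simp
  | succ k ih =>
    obtain ⟨g, hg, rfl⟩ := LocalRingOf.exists_mk_eq_of_mem_pow f (ih (by omega))
    obtain ⟨P, hP⟩ := exists_isLeadingForm hg
    refine mk_mem_pow_succ_of_dvd hf hP (dvd_of_mem_arcFiltration hf hF0 hred hP ?_)
    exact (mem_arcFiltration_iff f).2 fun φ =>
      (Nat.cast_le.2 hk).trans ((mem_arcFiltration_iff f).1 hx φ)

variable (f) in
/-- The class in `𝒪_{V,0}` of a homogeneous polynomial of degree `k`. -/
def mkOfPoly (k : ℕ) : MvPolynomial.homogeneousSubmodule (Fin m) ℂ k →ₗ[ℂ] LocalRingOf f :=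
  (Ideal.Quotient.mkₐ ℂ (Ideal.span {(f : HolGerm (Fin m → ℂ))})).toLinearMap ∘ₗ
    ofPoly.toLinearMap ∘ₗ Submodule.subtype _

theorem mkOfPoly_mem (k : ℕ) (P : MvPolynomial.homogeneousSubmodule (Fin m) ℂ k) :
    mkOfPoly f k P ∈ (arcFiltration f k).restrictScalars ℂ :=
  pow_le_arcFiltration f k (LocalRingOf.mk_mem_maximalIdeal_pow f (ofPoly_mem_pow P.2))

theorem exists_sub_mkOfPoly_mem (hf : IsLeadingForm (f : HolGerm (Fin m → ℂ)) F d) (hF0 : F ≠ 0)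
    (hred : IsReduced (ConeRing F)) (k : ℕ) (x : LocalRingOf f)
    (hx : x ∈ (arcFiltration f k).restrictScalars ℂ) :
    ∃ P, x - mkOfPoly f k P ∈ (arcFiltration f (k + 1)).restrictScalars ℂ := by
  have hx' : x ∈ arcFiltration f k := hx
  rw [arcFiltration_eq_pow hf hF0 hred] at hx'
  obtain ⟨g, hg, rfl⟩ := LocalRingOf.exists_mk_eq_of_mem_pow f hx'
  obtain ⟨P, hP⟩ := exists_isLeadingForm hg
  refine ⟨⟨P, hP.isHomogeneous⟩, pow_le_arcFiltration f _ ?_⟩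
  have h := LocalRingOf.mk_mem_maximalIdeal_pow f hP.sub_mem
  rwa [map_sub] at h

/-- The kernel of the map from the forms of degree `k` to `F_k / F_{k+1}` consists of the multiples
of the equation of the tangent cone. -/
theorem mkOfPoly_mem_succ_iff (hf : IsLeadingForm (f : HolGerm (Fin m → ℂ)) F d) (hF0 : F ≠ 0)
    (hred : IsReduced (ConeRing F)) {k : ℕ}
    (P : MvPolynomial.homogeneousSubmodule (Fin m) ℂ k) :
    mkOfPoly f k P ∈ (arcFiltration f (k + 1)).restrictScalars ℂ ↔
      F ∣ (P : MvPolynomial (Fin m) ℂ) := by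
  have hP : IsLeadingForm (ofPoly (P : MvPolynomial (Fin m) ℂ)) P k := ⟨P.2, by simp⟩
  exact ⟨fun h => dvd_of_mem_arcFiltration hf hF0 hred hP h,
    fun h => pow_le_arcFiltration f _ (mk_mem_pow_succ_of_dvd hf hP h)⟩

/-- The forms of degree `k` that are divisible by a form of degree `d` make up a space isomorphic to
that of the forms of degree `k - d`. -/
theorem MvPolynomial.IsHomogeneous.finrank_of_forall_mem_iff_dvd (hF : F.IsHomogeneous d)
    (hF0 : F ≠ 0) {k : ℕ} {K : Submodule ℂ (MvPolynomial.homogeneousSubmodule (Fin m) ℂ k)}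
    (hK : ∀ P, P ∈ K ↔ F ∣ (P : MvPolynomial (Fin m) ℂ)) :
    Module.finrank ℂ K =
      if d ≤ k then Module.finrank ℂ (MvPolynomial.homogeneousSubmodule (Fin m) ℂ (k - d))
      else 0 := by
  split_ifs with hdk
  · let μ : MvPolynomial.homogeneousSubmodule (Fin m) ℂ (k - d) →ₗ[ℂ]
        MvPolynomial.homogeneousSubmodule (Fin m) ℂ k :=
      (LinearMap.mulLeft ℂ F).restrict fun Q hQ => by
        have := hF.mul hQ
        rwa [Nat.add_sub_cancel' hdk] at this
    have hμ : Function.Injective μ := fun Q Q' h =>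
      Subtype.ext (mul_left_cancel₀ hF0 (congrArg Subtype.val h))
    have hKμ : K = LinearMap.range μ := by
      ext P
      rw [hK]
      constructor
      · intro h
        obtain ⟨Q, hQ, hPQ⟩ := hF.exists_eq_mul P.2 hdk h
        exact ⟨⟨Q, hQ⟩, Subtype.ext hPQ.symm⟩
      · rintro ⟨Q, rfl⟩
        exact Dvd.intro _ rfl
    rw [hKμ, LinearMap.finrank_range_of_inj hμ]
  · have hbot : K = ⊥ := eq_bot_iff.2 fun P hP =>
      Subtype.ext (hF.eq_zero_of_dvd P.2 (not_le.1 hdk) ((hK P).1 hP))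
    rw [hbot, finrank_bot]

theorem finrank_arcGraded_add (hf : IsLeadingForm (f : HolGerm (Fin m → ℂ)) F d) (hF0 : F ≠ 0)
    (hred : IsReduced (ConeRing F)) (k : ℕ) :
    Module.finrank ℂ (ArcGraded f k) +
        (if d ≤ k then Module.finrank ℂ (MvPolynomial.homogeneousSubmodule (Fin m) ℂ (k - d))
          else 0) =
      Module.finrank ℂ (MvPolynomial.homogeneousSubmodule (Fin m) ℂ k) := by
  have hfin : Module.Finite ℂ (MvPolynomial.homogeneousSubmodule (Fin m) ℂ k) :=
    Module.Finite.iff_fg.2 (MvPolynomial.homogeneousSubmodule_fg (Fin m) ℂ k)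
  have hK := hf.isHomogeneous.finrank_of_forall_mem_iff_dvd hF0
    (K := ((arcFiltration f (k + 1)).restrictScalars ℂ).comap (mkOfPoly f k))
    fun P => Submodule.mem_comap.trans (mkOfPoly_mem_succ_iff hf hF0 hred P)
  rw [← hK]
  exact Submodule.finrank_quotient_submoduleOf_add (mkOfPoly_mem k)
    (exists_sub_mkOfPoly_mem hf hF0 hred k)

end LeadingForms

theorem theorem2 (n d : ℕ)
    (f : IsLocalRing.maximalIdeal (HolGerm (Fin (n + 1) → ℂ)))
    (F : ℕ → MvPolynomial (Fin (n + 1)) ℂ)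
    (hF : HolGerm.IsHomogeneousExpansion (f : HolGerm (Fin (n + 1) → ℂ)) F)
    (hlow : ∀ k < d, F k = 0) (hd : F d ≠ 0)
    (hred : IsReduced (ConeRing (F d))) :
    (∀ i : ℕ, arcFiltration f i = IsLocalRing.maximalIdeal (LocalRingOf f) ^ i) ∧
      (∀ i : ℕ, Module.Finite ℂ (ArcGraded f i)) ∧
      poincareSeries f =
        (1 - PowerSeries.X ^ d) * ((1 - PowerSeries.X : PowerSeries ℚ) ^ (n + 1))⁻¹ := by
  have hf := hF.isLeadingForm hlow
  have hfin (k : ℕ) : Module.Finite ℂ (MvPolynomial.homogeneousSubmodule (Fin (n + 1)) ℂ k) :=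
    Module.Finite.iff_fg.2 (MvPolynomial.homogeneousSubmodule_fg (Fin (n + 1)) ℂ k)
  refine ⟨arcFiltration_eq_pow hf hd hred, fun i => ?_, ?_⟩
  · exact Submodule.finite_quotient_submoduleOf (mkOfPoly_mem i)
      (exists_sub_mkOfPoly_mem hf hd hred i)
  · have h1 : ((1 - PowerSeries.X : PowerSeries ℚ) ^ (n + 1))⁻¹ =
        PowerSeries.mk fun k => ((n + k).choose n : ℚ) := by
      rw [PowerSeries.inv_eq_iff_mul_eq_one (by simp)]
      exact PowerSeries.mk_add_choose_mul_one_sub_pow_eq_one ℚ n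
    rw [h1]
    refine PowerSeries.mk_eq_one_sub_X_pow_mul fun k => ?_
    have h2 := finrank_arcGraded_add hf hd hred k
    simp only [MvPolynomial.finrank_homogeneousSubmodule_fin_succ] at h2
    exact_mod_cast h2

end
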